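/- Let $k$ be a field and let $\Lambda$ be a finite dimensional (associative, unital) $k$-algebra. A \emph{system} of $\Lambda$ is a finite set $E$ of non-zero pairwise orthogonal idempotents of $\Lambda$ (not necessarily primitive) with $\sum_{x\in E}x=1$; it is \emph{trivial} if $E=\{1\}$. The \emph{Peirce $E$-quiver} has vertex set $E$ and, for distinct $x,y\in E$, an arrow from $x$ to $y$ whenever $y\Lambda x\neq 0$. The algebra $\Lambda$ is called \emph{$E$-triangular} if $E$ is a non-trivial system of $\Lambda$ whose Peirce $E$-quiver has no oriented cycles. If $\Lambda$ is $E$-triangular with respect to a system $E$, and for every $x\in E$ the algebra $x\Lambda x$ (with unit $x$) has finite global dimension, then $\Lambda$ has finite global dimension. -/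

import Mathlib

universe u

open CategoryTheory

/-- The (left) global dimension of a ring `R`: the supremum of the projective dimensions of all
left `R`-modules. (It is `⊥` for the zero ring.) -/
noncomputable def globalDimension (R : Type u) [Ring R] : WithBot ℕ∞ :=
  ⨆ M : ModuleCat.{u} R, projectiveDimension M

/-- A ring has finite global dimension. -/
def HasFiniteGlobalDimension (R : Type u) [Ring R] : Prop :=
  globalDimension R < ⊤

/-- A system of a ring `Λ`: a finite set of nonzero pairwise orthogonal idempotents (not
necessarily primitive) whose sum is `1`. -/
structure IsSystem {Λ : Type u} [Ring Λ] (E : Finset Λ) : Prop where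
  completeOrthogonal : CompleteOrthogonalIdempotents (fun x : E => (x : Λ))
  ne_zero : ∀ x ∈ E, x ≠ 0

/-- The Peirce quiver of `E`: the vertices are the elements of `E`, and there is an arrow
from `x` to `y`, for `x ≠ y`, exactly when `yΛx ≠ 0`. -/
@[reducible] def peirceQuiver {Λ : Type u} [Ring Λ] (E : Finset Λ) : Quiver E where
  Hom x y := PLift (x ≠ y ∧ ∃ a : Λ, (y : Λ) * a * (x : Λ) ≠ 0)

/-- `Λ` is `E`-triangular: `E` is a system other than the trivial system `{1}`, and its Peirce
quiver has no oriented cycles (no oriented path of positive length returns to its start). -/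
structure IsTriangular {Λ : Type u} [Ring Λ] (E : Finset Λ) : Prop extends IsSystem E where
  nontrivial : E ≠ {1}
  acyclic : letI := peirceQuiver E
    ∀ (x : E) (p : Quiver.Path x x), p.length = 0

/-! Induct on a successor-closed set V of vertices, bounding the projective dimension of all modules
M supported on V. Acyclicity gives a source i of V. The elements of M killed by e_i form a submodule
K supported on V \ {i}, which is again successor-closed, and M/K is supported at i. Modules
supported at i are restrictions along a ↦ e_i a e_i, a ring homomorphism Λ → e_iΛe_i because no
2-cycle passes through i. As a Λ-module, e_iΛe_i is the quotient of the projective Λe_i by a module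
supported on V \ {i}, so change of rings (`hasProjectiveDimensionLT_restrictScalars`) bounds them.
-/

namespace PeirceTriangular

section ChangeOfRings

variable {S R : Type u} [Ring S] [Ring R]

/-- Restriction of scalars preserves short exact sequences. -/
lemma shortExact_map_restrictScalars (φ : S →+* R) {T : ShortComplex (ModuleCat.{u} R)}
    (hT : T.ShortExact) : (T.map (ModuleCat.restrictScalars.{u} φ)).ShortExact := by
  refine ModuleCat.shortComplex_shortExact _ ?_ ?_ ?_
  · have h := (ShortComplex.ShortExact.moduleCat_exact_iff_function_exact _).mp hT.exact
    exact h
  · exact hT.moduleCat_injective_f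
  · exact hT.moduleCat_surjective_g

/-- A projective module is a retract of a free module. -/
lemma exists_retract_finsupp (P : ModuleCat.{u} R) [Projective P] :
    Nonempty (Retract P (ModuleCat.of R (P →₀ R))) := by
  have : Module.Projective R P := (IsProjective.iff_projective P).mpr ‹_›
  obtain ⟨s, hs⟩ := this.out
  exact ⟨{
    i := ModuleCat.ofHom s
    r := ModuleCat.ofHom (Finsupp.linearCombination R id)
    retract := by
      ext m
      exact hs m }⟩

/-- Change of rings: if free `R`-modules have projective dimension `< b` over `S`, then
restriction of scalars raises projective dimensions by at most `b`. -/
theorem hasProjectiveDimensionLT_restrictScalars (φ : S →+* R) (b : ℕ)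
    (hfree : ∀ I : Type u, HasProjectiveDimensionLT
      ((ModuleCat.restrictScalars.{u} φ).obj (ModuleCat.of R (I →₀ R))) b) (n : ℕ) :
    ∀ N : ModuleCat.{u} R, HasProjectiveDimensionLT N n →
      HasProjectiveDimensionLT ((ModuleCat.restrictScalars.{u} φ).obj N) (b + n) := by
  have hproj (P : ModuleCat.{u} R) [Projective P] :
      HasProjectiveDimensionLT ((ModuleCat.restrictScalars.{u} φ).obj P) b := by
    obtain ⟨r⟩ := exists_retract_finsupp P
    have := hfree P
    exact (r.map (ModuleCat.restrictScalars.{u} φ)).hasProjectiveDimensionLT b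
  induction n with
  | zero =>
    intro N hN
    have : Projective N := (isZero_of_hasProjectiveDimensionLT_zero N).projective
    exact hproj N
  | succ n ih =>
    intro N hN
    -- Dimension `< 1` means projective; passing to a syzygy lowers the strict bound only from `n +
    -- 2` to `n + 1`.
    obtain _ | n := n
    · have : Projective N := projective_iff_hasProjectiveDimensionLT_one.mpr hN
      have := hproj N
      exact hasProjectiveDimensionLT_of_ge _ b _ (by lia)
    · have hT := N.shortExact_projectiveShortComplex
      have hX₂ : Projective N.projectiveShortComplex.X₂ :=
        (IsProjective.iff_projective _).mp inferInstance
      have h₁ := ih _ ((hT.hasProjectiveDimensionLT_X₃_iff n hX₂).mp hN)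
      have h₂ := hproj N.projectiveShortComplex.X₂
      have h₂' := hasProjectiveDimensionLT_of_ge
        ((ModuleCat.restrictScalars.{u} φ).obj N.projectiveShortComplex.X₂) b
        (b + (n + 1) + 1) (by lia)
      exact (shortExact_map_restrictScalars φ hT).hasProjectiveDimensionLT_X₃ (b + (n + 1)) h₁ h₂'

end ChangeOfRings

section GlobalDimension

variable {R : Type u} [Ring R]

/-- The bound `n` is strict, so the value `⊥` is covered by `n = 0`. -/
lemma hasFiniteGlobalDimension_iff : HasFiniteGlobalDimension R ↔
    ∃ n : ℕ, ∀ M : ModuleCat.{u} R, HasProjectiveDimensionLT M n := by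
  constructor
  · intro h
    obtain ⟨n, hn⟩ : ∃ n : ℕ, globalDimension R < n := by
      have h' : globalDimension R < ⊤ := h
      generalize globalDimension R = d at h'
      induction d with
      | bot => exact ⟨0, WithBot.bot_lt_coe _⟩
      | coe d =>
        induction d with
        | top => exact absurd h' (lt_irrefl _)
        | coe d => exact ⟨d + 1, by exact_mod_cast d.lt_succ_self⟩
    exact ⟨n, fun M => projectiveDimension_lt_iff.mp ((le_iSup _ M).trans_lt hn)⟩
  · rintro ⟨n, hn⟩
    have h : globalDimension R ≤ n :=
      iSup_le fun M => (projectiveDimension_lt_iff.mpr (hn M)).le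
    exact h.trans_lt (WithBot.coe_lt_coe.mpr (ENat.natCast_lt_top n))

end GlobalDimension

variable {Λ : Type u} [Ring Λ]

/-- Multiplication on both sides by an idempotent `x`, as a ring homomorphism `Λ → xΛx`, under
the hypothesis that it is multiplicative. -/
def toCorner {x : Λ} (hx : IsIdempotentElem x)
    (hmul : ∀ a b : Λ, x * (a * b) * x = x * a * x * (x * b * x)) : Λ →+* hx.Corner where
  toFun a := ⟨x * a * x, a, rfl⟩
  map_one' := Subtype.ext ((congrArg (· * x) (mul_one x)).trans hx.eq)
  map_mul' a b := Subtype.ext (hmul a b)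
  map_zero' := Subtype.ext ((congrArg (· * x) (mul_zero x)).trans (zero_mul x))
  map_add' a b := Subtype.ext (by simp only [mul_add, add_mul]; rfl)

/-- A module on which the idempotent `x` acts as the identity is a module over `xΛx`. -/
abbrev cornerModule {x : Λ} (hx : IsIdempotentElem x) {M : Type*} [AddCommGroup M] [Module Λ M]
    (h : ∀ m : M, x • m = m) : Module hx.Corner M where
  smul r m := r.1 • m
  one_smul m := h m
  mul_smul r s m := mul_smul r.1 s.1 m
  smul_zero r := smul_zero r.1
  smul_add r := smul_add r.1
  add_smul r s m := add_smul r.1 s.1 m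
  zero_smul m := zero_smul Λ m

lemma projective_span_idempotent {x : Λ} (hx : IsIdempotentElem x) :
    Module.Projective Λ (Ideal.span {x} : Ideal Λ) := by
  refine Module.Projective.of_split (M := Λ) (Submodule.subtype _)
    ((LinearMap.toSpanSingleton Λ Λ x).codRestrict _
      fun a => Ideal.mul_mem_left _ a (Ideal.mem_span_singleton_self x)) ?_
  ext ⟨a, ha⟩
  obtain ⟨c, rfl⟩ := Ideal.mem_span_singleton'.mp ha
  change c * x * x = c * x
  rw [mul_assoc, hx.eq]

section Support

variable {ι : Type*} (e : ι → Λ)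

/-- There is an arrow from `i` to `j` in the Peirce quiver. -/
def Arrow (i j : ι) : Prop := i ≠ j ∧ ∃ a : Λ, e j * a * e i ≠ 0

/-- A module is supported on `V` if `eᵢM = 0` for all `i` outside `V`. -/
def IsSupportedOn (V : Finset ι) (M : Type*) [AddCommGroup M] [Module Λ M] : Prop :=
  ∀ i ∉ V, ∀ m : M, e i • m = 0

variable {e}

lemma Arrow.eq_zero_of_not {i j : ι} (h : ¬ Arrow e i j) (hij : i ≠ j) (a : Λ) :
    e j * a * e i = 0 := by
  by_contra ha
  exact h ⟨hij, a, ha⟩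

variable [Fintype ι]

/-- If no arrow is reversed by another one, then `a ↦ eᵢ a eᵢ` is multiplicative. -/
lemma mul_corner (he : CompleteOrthogonalIdempotents e)
    (hr : ∀ i j, Arrow e i j → ¬ Arrow e j i) (i : ι) (a b : Λ) :
    e i * (a * b) * e i = e i * a * e i * (e i * b * e i) := by
  calc e i * (a * b) * e i = e i * a * (∑ j, e j) * (b * e i) := by
        rw [he.complete]; simp only [mul_assoc, one_mul]
    _ = ∑ j, (e i * a * e j) * (b * e i) := by rw [Finset.mul_sum, Finset.sum_mul]
    _ = (e i * a * e i) * (b * e i) := by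
        refine Finset.sum_eq_single i (fun j _ hj => ?_) (by simp)
        -- A nonzero term through j ≠ i would need arrows both ways between i and j.
        by_cases h : Arrow e j i
        · have h' := Arrow.eq_zero_of_not (hr _ _ h) hj.symm b
          calc e i * a * e j * (b * e i) = e i * a * (e j * e j) * (b * e i) := by
                rw [(he.idem j).eq]
            _ = e i * a * e j * (e j * b * e i) := by simp only [mul_assoc]
            _ = 0 := by rw [h', mul_zero]
        · rw [Arrow.eq_zero_of_not h hj, zero_mul]
    _ = (e i * a * (e i * e i)) * (b * e i) := by rw [(he.idem i).eq]
    _ = _ := by simp only [mul_assoc]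

lemma IsSupportedOn.smul_eq_self (he : CompleteOrthogonalIdempotents e) {i : ι} {M : Type*}
    [AddCommGroup M] [Module Λ M] (hM : IsSupportedOn e {i} M) (m : M) : e i • m = m := by
  conv_rhs => rw [← one_smul Λ m, ← he.complete, Finset.sum_smul]
  exact (Finset.sum_eq_single i (fun j _ hj => hM j (by simpa using hj) m) (by simp)).symm

variable [DecidableEq ι]

/-- The projective dimension of modules supported at a single vertex `i` is controlled by the
global dimension of the corner at `i` and by the modules supported on `V`, where `V` contains all
the successors of `i`. -/
lemma exists_bound_of_isSupportedOn_singleton (he : CompleteOrthogonalIdempotents e)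
    (hr : ∀ i j, Arrow e i j → ¬ Arrow e j i) (i : ι)
    (hi : HasFiniteGlobalDimension (he.idem i).Corner)
    (V : Finset ι) (hV : ∀ j, Arrow e i j → j ∈ V) (b : ℕ)
    (hb : ∀ M : ModuleCat.{u} Λ, IsSupportedOn e V M → HasProjectiveDimensionLT M b) :
    ∃ n : ℕ, ∀ M : ModuleCat.{u} Λ, IsSupportedOn e {i} M → HasProjectiveDimensionLT M n := by
  obtain ⟨d, hd⟩ := hasFiniteGlobalDimension_iff.mp hi
  let φ := toCorner (he.idem i) (mul_corner he hr i)
  have hφ (a : Λ) : (φ a).1 = e i * a * e i := rfl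
  have hfree (I : Type u) : HasProjectiveDimensionLT ((ModuleCat.restrictScalars.{u} φ).obj
      (ModuleCat.of _ (I →₀ (he.idem i).Corner))) (b + 1) := by
    let L : Ideal Λ := Ideal.span {e i}
    have : Module.Projective Λ L := projective_span_idempotent (he.idem i)
    have hL (a : L) : a.1 * e i = a.1 := by
      obtain ⟨c, hc⟩ := Ideal.mem_span_singleton'.mp a.2
      rw [← hc, mul_assoc, (he.idem i).eq]
    let ψ : L →+ (he.idem i).Corner := φ.toAddMonoidHom.comp L.subtype.toAddMonoidHom
    have hψ (a : L) : ψ a = φ a.1 := rfl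
    let N := (ModuleCat.restrictScalars.{u} φ).obj (ModuleCat.of _ (I →₀ (he.idem i).Corner))
    let f : (I →₀ L) →ₗ[Λ] N :=
      { toFun := fun v => (Finsupp.mapRange ψ (map_zero ψ) v : I →₀ (he.idem i).Corner)
        map_add' := fun v w => Finsupp.mapRange_add (map_add ψ) v w
        map_smul' := fun a v => by
          refine Finsupp.ext (f := Finsupp.mapRange ψ (map_zero ψ) (a • v))
            (g := φ a • Finsupp.mapRange ψ (map_zero ψ) v) fun t => ?_
          simp only [Finsupp.mapRange_apply, Finsupp.smul_apply, hψ, smul_eq_mul]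
          exact map_mul φ a (v t).1 }
    have hfapp (v : I →₀ L) (t : I) : (show I →₀ (he.idem i).Corner from f v) t = φ (v t).1 := rfl
    have hf : Function.Surjective f := by
      refine Finsupp.mapRange_surjective ψ (map_zero ψ) fun r => ?_
      have hr := (Subsemigroup.mem_corner_iff (he.idem i)).mp r.2
      refine ⟨⟨r.1, Ideal.mem_span_singleton'.mpr ⟨r.1, hr.2⟩⟩, Subtype.ext ?_⟩
      rw [hψ, hφ, hr.1, hr.2]
    -- At j ≠ i the kernel has entries in e_jΛe_i, zero unless i → j; at i it vanishes because `φ`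
    -- fixes e_iΛe_i.
    have hK : IsSupportedOn e V (LinearMap.ker f) := by
      intro j hj ⟨v, hv⟩
      refine Subtype.ext (Finsupp.ext fun t => Subtype.ext ?_)
      change e j * (v t).1 = 0
      rw [← hL, ← mul_assoc]
      by_cases hij : i = j
      · subst hij
        have h0 : φ (v t).1 = 0 := by
          rw [← hfapp, LinearMap.mem_ker.mp hv]; rfl
        exact congrArg Subtype.val h0
      · exact Arrow.eq_zero_of_not (fun h => hj (hV j h)) hij _
    have hP : Projective f.shortComplexKer.X₂ := (IsProjective.iff_projective _).mp
      (by
      classical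
      exact Module.Projective.of_equiv (finsuppLequivDFinsupp (M := L) (ι := I) Λ).symm)
    exact (LinearMap.shortExact_shortComplexKer hf).hasProjectiveDimensionLT_X₃ b
      (hb (ModuleCat.of Λ (LinearMap.ker f)) hK) (hasProjectiveDimensionLT_of_ge _ 1 _ (by lia))
  refine ⟨b + 1 + d, fun M hM => ?_⟩
  have hMi := hM.smul_eq_self he
  let := cornerModule (he.idem i) hMi
  let N := (ModuleCat.restrictScalars.{u} φ).obj (ModuleCat.of (he.idem i).Corner M)
  have := hasProjectiveDimensionLT_restrictScalars φ (b + 1) hfree d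
    (ModuleCat.of (he.idem i).Corner M) (hd _)
  let l : N ≃ₗ[Λ] M :=
    { AddEquiv.refl M with
      map_smul' := fun a m => by
        change (e i * a * e i) • (show M from m) = a • (show M from m)
        rw [mul_smul, mul_smul, hMi, hMi] }
  exact hasProjectiveDimensionLT_of_iso l.toModuleIso _

/-- Modules supported on a successor-closed set of vertices have bounded projective dimension. -/
theorem exists_bound_of_isSupportedOn (he : CompleteOrthogonalIdempotents e)
    (hwf : WellFounded (Arrow e))
    (hcorner : ∀ i, HasFiniteGlobalDimension (he.idem i).Corner) (V : Finset ι)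
    (hV : ∀ i ∈ V, ∀ j, Arrow e i j → j ∈ V) :
    ∃ n : ℕ, ∀ M : ModuleCat.{u} Λ, IsSupportedOn e V M → HasProjectiveDimensionLT M n := by
  induction hn : V.card generalizing V with
  | zero =>
    obtain rfl := Finset.card_eq_zero.mp hn
    refine ⟨0, fun M hM => ?_⟩
    have : Subsingleton M := subsingleton_of_forall_eq 0 fun m => by
      rw [← one_smul Λ m, ← he.complete, Finset.sum_smul]
      exact Finset.sum_eq_zero fun i _ => hM i (by simp) m
    exact (ModuleCat.isZero_of_subsingleton M).hasProjectiveDimensionLT_zero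
  | succ n ih =>
    -- Minimal means that i receives no arrow from V.
    obtain ⟨i, hi, hmin⟩ := hwf.has_min (V : Set ι) (Finset.card_pos.mp (by lia))
    have hi : i ∈ V := hi
    have hr : ∀ i j, Arrow e i j → ¬ Arrow e j i := fun _ _ h h' => hwf.asymmetric _ _ h h'
    obtain ⟨b, hb⟩ := ih (V.erase i) (fun j hj l hjl => Finset.mem_erase.mpr
      ⟨fun h => hmin j (Finset.mem_of_mem_erase hj) (h ▸ hjl),
        hV j (Finset.mem_of_mem_erase hj) l hjl⟩)
      (by rw [Finset.card_erase_of_mem hi, hn]; rfl)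
    obtain ⟨c, hc⟩ := exists_bound_of_isSupportedOn_singleton he hr i (hcorner i) (V.erase i)
      (fun j hj => Finset.mem_erase.mpr ⟨hj.1.symm, hV i hi j hj⟩) b hb
    refine ⟨max b c, fun M hM => ?_⟩
    let K : Submodule Λ M :=
      { carrier := {m | e i • m = 0}
        add_mem' := fun {m m'} (hm : e i • m = 0) (hm' : e i • m' = 0) => by
          change e i • (m + m') = 0
          rw [smul_add, hm, hm', add_zero]
        zero_mem' := smul_zero _
        smul_mem' := fun a m (hm : e i • m = 0) => by
          change e i • a • m = 0
          -- Split m = ∑ e_j m: for j ≠ i in V, e_i a e_j = 0 since i is a source of V.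
          rw [← one_smul Λ m, ← he.complete, Finset.sum_smul, Finset.smul_sum, Finset.smul_sum]
          refine Finset.sum_eq_zero fun j _ => ?_
          by_cases hij : j = i
          · rw [hij, hm, smul_zero, smul_zero]
          · by_cases hj : j ∈ V
            · rw [← mul_smul, ← mul_smul,
                Arrow.eq_zero_of_not (hmin j hj) hij, zero_smul]
            · rw [hM j hj, smul_zero, smul_zero] }
    have hmemK {m : M} : m ∈ K ↔ e i • m = 0 := Iff.rfl
    have hK : IsSupportedOn e (V.erase i) (LinearMap.ker K.mkQ) := by
      rintro j hj ⟨m, hm⟩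
      rw [Submodule.ker_mkQ] at hm
      refine Subtype.ext ?_
      change e j • m = 0
      by_cases hij : j = i
      · exact hij ▸ hm
      · exact hM j (fun h => hj (Finset.mem_erase.mpr ⟨hij, h⟩)) m
    have hQ : IsSupportedOn e {i} (M ⧸ K) := by
      intro j hj q
      obtain ⟨m, rfl⟩ := K.mkQ_surjective q
      rw [← map_smul, ← LinearMap.mem_ker, Submodule.ker_mkQ, hmemK, ← mul_smul,
        he.ortho (fun h => hj (by simp [h])), zero_smul]
    have h₁ := hb (ModuleCat.of Λ (LinearMap.ker K.mkQ)) hK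
    have h₃ := hc (ModuleCat.of Λ (M ⧸ K)) hQ
    exact (LinearMap.shortExact_shortComplexKer K.mkQ_surjective).hasProjectiveDimensionLT_X₂ _
      (hasProjectiveDimensionLT_of_ge _ b _ (le_max_left _ _))
      (hasProjectiveDimensionLT_of_ge _ c _ (le_max_right _ _))

end Support

/-- The arrow relation of an acyclic Peirce quiver is well founded. -/
lemma wellFounded_arrow {E : Finset Λ} (hE : IsTriangular E) :
    WellFounded (Arrow (fun x : E => (x : Λ))) := by
  let := peirceQuiver E
  -- Acyclicity makes this transitive relation irreflexive, hence well founded on the finite set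
  -- `E`.
  let r (x y : E) : Prop := ∃ p : Quiver.Path x y, 0 < p.length
  have : IsTrans E r := ⟨fun x y z ⟨p, hp⟩ ⟨q, _⟩ =>
    ⟨p.comp q, by rw [Quiver.Path.length_comp]; lia⟩⟩
  have : Std.Irrefl r := ⟨fun x ⟨p, hp⟩ => hp.ne' (hE.acyclic x p)⟩
  refine Subrelation.wf (fun {x y} h => ?_) (Finite.wellFounded_of_trans_of_irrefl r)
  let f : x ⟶ y := PLift.up h
  exact ⟨f.toPath, Nat.one_pos⟩

end PeirceTriangular

theorem mainTheorem12 {k : Type*} [Field k] {Λ : Type u} [Ring Λ] [Algebra k Λ]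
    [FiniteDimensional k Λ] (E : Finset Λ) (hE : IsTriangular E)
    (hcorner : ∀ x : E, HasFiniteGlobalDimension (hE.completeOrthogonal.idem x).Corner) :
    HasFiniteGlobalDimension Λ := by
  classical
  obtain ⟨n, hn⟩ := PeirceTriangular.exists_bound_of_isSupportedOn hE.completeOrthogonal
    (PeirceTriangular.wellFounded_arrow hE) hcorner Finset.univ fun _ _ _ _ => Finset.mem_univ _
  exact PeirceTriangular.hasFiniteGlobalDimension_iff.mpr
    ⟨n, fun M => hn M fun i hi => absurd (Finset.mem_univ i) hi⟩
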